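/- Let $\mathcal{A}$ be the disc algebra, i.e. the complex Banach algebra, under the supremum norm, of all continuous functions $f:\{z\in\mathbb{C}:|z|\le 1\}\to\mathbb{C}$ that are holomorphic on $\{|z|<1\}$. Then every element of $\mathrm{SL}_2(\mathcal{A})$ is a product of two exponentials: for every $2\times 2$ matrix $M$ over $\mathcal{A}$ with $\det M=1$ there are $2\times 2$ matrices $X,Y$ over $\mathcal{A}$ with $\operatorname{tr}X=\operatorname{tr}Y=0$ such that $$M=\exp(X)\exp(Y),$$ where $\exp(X)=\sum_{n\ge 0}X^n/n!$ is the matrix exponential over $\mathcal{A}$. -/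

import Mathlib

/-- The disc algebra: continuous functions on the closed unit disc in `ℂ` that are holomorphic on
the open unit disc, as a subalgebra of `C(closed disc, ℂ)`. In particular it carries the supremum
norm and the topology of uniform convergence. The value `0` of the extension outside the closed
disc plays no role, since the open disc is an open subset of the closed disc. -/
def discAlgebra : Subalgebra ℂ C(Metric.closedBall (0 : ℂ) 1, ℂ) where
  carrier := {f | DifferentiableOn ℂ (Function.extend Subtype.val f 0) (Metric.ball (0 : ℂ) 1)}
  mul_mem' := by
    intro f g hf hg
    refine (DifferentiableOn.mul hf hg).congr fun z hz => ?_
    have h (k : Metric.closedBall (0 : ℂ) 1 → ℂ) : Function.extend Subtype.val k 0 z =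
        k ⟨z, Metric.ball_subset_closedBall hz⟩ :=
      Subtype.val_injective.extend_apply k 0 ⟨z, Metric.ball_subset_closedBall hz⟩
    simp [h]
  add_mem' := by
    intro f g hf hg
    refine (DifferentiableOn.add hf hg).congr fun z hz => ?_
    have h (k : Metric.closedBall (0 : ℂ) 1 → ℂ) : Function.extend Subtype.val k 0 z =
        k ⟨z, Metric.ball_subset_closedBall hz⟩ :=
      Subtype.val_injective.extend_apply k 0 ⟨z, Metric.ball_subset_closedBall hz⟩
    simp [h]
  algebraMap_mem' := by
    intro c
    refine (differentiableOn_const c).congr fun z hz => ?_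
    have h (k : Metric.closedBall (0 : ℂ) 1 → ℂ) : Function.extend Subtype.val k 0 z =
        k ⟨z, Metric.ball_subset_closedBall hz⟩ :=
      Subtype.val_injective.extend_apply k 0 ⟨z, Metric.ball_subset_closedBall hz⟩
    simp [h]

/-!
Let `A` be a commutative complex Banach algebra topologically generated by one element `a`. If
`(f, g)` is unimodular over `A`, then some `f + α * g` is an exponential. Indeed, among `f` coprime
to `g` this property is locally constant, because the exponentials form a neighbourhood of `1`, so
by density and multiplicativity it is enough to treat `f = a - w`. Were the set `V` of bad `w`
nonempty, it would be bounded and no `a - w` with `w ∈ frontier V` could be coprime to `g`. But for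
`w₀ ∈ V`, approximating `u` in `u * (a - w₀) + v * g = 1` by a polynomial `p` in `a`, the polynomial
`1 - p(w) * (w - w₀)` is `1` at `w₀` and, since it is close to a multiple of `g` in `A`, smaller
than `1` in modulus on `frontier V`, against the maximum principle.

For `M` of determinant one, conjugation by an upper unipotent matrix therefore makes the top left
entry an exponential `exp (x + y)`, where shifting `x` and `y` by opposite constants achieves that
`exp x - exp (-x)` and `exp y - exp (-y)` are units. The matrix is then lower triangular with
diagonal `exp x, exp (-x)` times upper triangular with diagonal `exp y, exp (-y)`, and each factor
is an exponential since it is conjugate to its diagonal.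

The disc algebra is generated by the coordinate function: the dilations `f (w * z)` with `‖w‖ < 1`
are uniform limits of their Taylor polynomials, and they tend to `f` as `w` tends to `1`.
-/

open Bornology Filter Metric NormedSpace Polynomial Set
open scoped Topology

section Exp

variable {A : Type*} [NormedRing A]

theorem exp_mul_exp_neg [NormedAlgebra ℚ A] [CompleteSpace A] (x : A) : exp x * exp (-x) = 1 := by
  rw [← exp_add_of_commute (Commute.refl x).neg_right, add_neg_cancel, exp_zero]

variable [NormedAlgebra ℂ A]

theorem exp_algebraMap_log {c : ℂ} (hc : c ≠ 0) :
    exp (algebraMap ℂ A (Complex.log c)) = algebraMap ℂ A c := by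
  rw [← algebraMap_exp_comm, ← Complex.exp_eq_exp_ℂ, Complex.exp_log hc]

variable [CompleteSpace A]

theorem range_exp_mem_nhds_one : range (exp : A → A) ∈ 𝓝 1 := by
  have hmap : map exp (𝓝 (0 : A)) = 𝓝 1 := by
    rw [← exp_zero]
    exact (hasStrictFDerivAt_exp_zero (𝕂 := ℂ)).map_nhds_eq_of_surj (LinearMap.range_eq_top.2
      Function.surjective_id)
  exact hmap ▸ range_mem_map

theorem eventually_cobounded_sub_algebraMap_mem_range_exp (a : A) :
    ∀ᶠ w : ℂ in cobounded ℂ, a - algebraMap ℂ A w ∈ range (exp : A → A) := by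
  let +nondep : NormedAlgebra ℚ A := .restrictScalars ℚ ℂ A
  have hlim : Tendsto (fun w : ℂ ↦ 1 - w⁻¹ • a) (cobounded ℂ) (𝓝 1) := by
    simpa using ((tendsto_inv₀_cobounded (α := ℂ)).smul_const a).const_sub 1
  filter_upwards [hlim range_exp_mem_nhds_one, eventually_ne_cobounded 0] with w ⟨x, hx⟩ hw
  refine ⟨algebraMap ℂ A (Complex.log (-w)) + x, ?_⟩
  rw [exp_add_of_commute (Algebra.commutes _ x), exp_algebraMap_log (neg_ne_zero.2 hw), hx,
    mul_sub, mul_one, ← Algebra.smul_def, smul_smul, neg_mul, mul_inv_cancel₀ hw, map_neg,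
    neg_one_smul, sub_neg_eq_add, neg_add_eq_sub]

end Exp

section ExpReducible

section TopologicalRing

variable {R : Type*} [CommRing R] [TopologicalSpace R] [IsTopologicalRing R]

/-- `f` is exponentially reducible modulo `g` if it is congruent modulo `g` to an exponential. This
sharpens reducibility of the pair `(f, g)` in the sense of the Bass stable rank, where `f` is only
required to be congruent modulo `g` to a unit. -/
def ExpReducible (f g : R) : Prop :=
  ∃ α, f + α * g ∈ range (exp : R → R)

theorem expReducible_of_mem_range_exp {f : R} (hf : f ∈ range (exp : R → R)) (g : R) :
    ExpReducible f g :=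
  ⟨0, by simpa using hf⟩

theorem expReducible_add_mul_iff {f g : R} (c : R) :
    ExpReducible (f + c * g) g ↔ ExpReducible f g := by
  constructor
  · rintro ⟨α, hα⟩
    exact ⟨c + α, by rwa [add_mul, ← add_assoc]⟩
  · rintro ⟨α, hα⟩
    exact ⟨α - c, by rwa [sub_mul, add_add_sub_cancel]⟩

end TopologicalRing

variable {A : Type*} [NormedCommRing A]

section Rat

variable [NormedAlgebra ℚ A] [CompleteSpace A]

theorem ExpReducible.mul {f₁ f₂ g : A} (h₁ : ExpReducible f₁ g) (h₂ : ExpReducible f₂ g) :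
    ExpReducible (f₁ * f₂) g := by
  obtain ⟨α, x, hx⟩ := h₁
  obtain ⟨β, y, hy⟩ := h₂
  refine ⟨f₁ * β + α * f₂ + α * β * g, x + y, ?_⟩
  rw [exp_add, hx, hy]
  ring

theorem expReducible_multiset_prod {s : Multiset A} {g : A} (h : ∀ f ∈ s, ExpReducible f g) :
    ExpReducible s.prod g :=
  Multiset.prod_induction (ExpReducible · g) s (fun _ _ ↦ ExpReducible.mul)
    (expReducible_of_mem_range_exp ⟨0, exp_zero⟩ g) h

theorem expReducible_mul_exp_iff {f g : A} (x : A) :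
    ExpReducible (f * exp x) g ↔ ExpReducible f g := by
  refine ⟨fun h ↦ ?_, fun h ↦ h.mul (expReducible_of_mem_range_exp ⟨x, rfl⟩ g)⟩
  simpa only [mul_assoc, exp_mul_exp_neg, mul_one] using
    h.mul (expReducible_of_mem_range_exp ⟨-x, rfl⟩ g)

end Rat

variable [NormedAlgebra ℂ A] [CompleteSpace A]

theorem eventually_expReducible_iff_of_isCoprime {f g : A} (h : IsCoprime f g) :
    ∀ᶠ f' in 𝓝 f, IsCoprime f' g ∧ (ExpReducible f' g ↔ ExpReducible f g) := by
  let +nondep : NormedAlgebra ℚ A := .restrictScalars ℚ ℂ A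
  obtain ⟨u, v, huv⟩ := h
  have hlim : Tendsto (fun f' ↦ 1 + (f' - f) * u) (𝓝 f) (𝓝 1) :=
    (by fun_prop : Continuous fun f' ↦ 1 + (f' - f) * u).tendsto' _ _ (by simp)
  filter_upwards [hlim range_exp_mem_nhds_one] with f' ⟨x, hx⟩
  have hf' : f' = f * exp x + (f' - f) * v * g := by
    rw [hx]
    linear_combination (f - f') * huv
  rw [hf', IsCoprime.add_mul_right_left_iff, isCoprime_mul_unit_right_left (isUnit_exp x),
    expReducible_add_mul_iff, expReducible_mul_exp_iff]
  exact ⟨⟨u, v, huv⟩, Iff.rfl⟩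

end ExpReducible

section SinglyGenerated

theorem denseRange_aeval_of_elemental_eq_top {R A : Type*} [CommSemiring R] [Semiring A]
    [Algebra R A] [TopologicalSpace A] [IsTopologicalSemiring A] {a : A}
    (ha : Algebra.elemental R a = ⊤) : DenseRange (aeval a : R[X] → A) := by
  have hrange : range (aeval a : R[X] → A) = Algebra.adjoin R {a} := by
    rw [Algebra.adjoin_singleton_eq_range_aeval, AlgHom.coe_range]
  rw [DenseRange, hrange, dense_iff_closure_eq, ← Subalgebra.topologicalClosure_coe]
  exact congrArg SetLike.coe ha

theorem sub_algebraMap_dvd_aeval_sub {R A : Type*} [CommRing R] [Ring A] [Algebra R A]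
    (a : A) (w : R) (p : R[X]) :
    a - algebraMap R A w ∣ aeval a p - algebraMap R A (p.eval w) := by
  simpa using map_dvd (aeval a) (X_sub_C_dvd_sub_C_eval (a := w) (p := p))

variable {A : Type*} [NormedCommRing A] [NormedAlgebra ℂ A] [CompleteSpace A] {a g : A}

theorem norm_eval_le_of_not_isCoprime {w : ℂ} (h : ¬IsCoprime (a - algebraMap ℂ A w) g) (p : ℂ[X]) :
    ‖p.eval w‖ ≤ ‖aeval a p - g‖ * ‖(1 : A)‖ := by
  contrapose! h
  have hunit : IsUnit (algebraMap ℂ A (p.eval w) - (aeval a p - g)) :=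
    spectrum.mem_resolventSet_of_norm_lt_mul h
  obtain ⟨q, hq⟩ := sub_algebraMap_dvd_aeval_sub a w p
  have hg : g = algebraMap ℂ A (p.eval w) - (aeval a p - g) + (a - algebraMap ℂ A w) * q := by
    rw [← hq]
    ring
  rw [hg]
  exact (isCoprime_one_right.of_isCoprime_of_dvd_right hunit.dvd).add_mul_left_right q

theorem not_isCoprime_of_forall_mem_frontier (ha : Algebra.elemental ℂ a = ⊤) {V : Set ℂ}
    (hV : IsBounded V) (h : ∀ w ∈ frontier V, ¬IsCoprime (a - algebraMap ℂ A w) g) {w₀ : ℂ}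
    (hw₀ : w₀ ∈ V) : ¬IsCoprime (a - algebraMap ℂ A w₀) g := by
  rintro ⟨u, v, huv⟩
  obtain ⟨p, hp⟩ : ∃ p : ℂ[X], ‖(u - aeval a p) * (a - algebraMap ℂ A w₀)‖ * ‖(1 : A)‖ < 1 :=
    (denseRange_aeval_of_elemental_eq_top ha).exists_mem_open
      (isOpen_lt (f := fun x ↦ ‖(u - x) * (a - algebraMap ℂ A w₀)‖ * ‖(1 : A)‖) (by fun_prop)
        continuous_const) ⟨u, by simp⟩
  set q : ℂ[X] := 1 - p * (X - C w₀) with hq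
  have hqa : aeval a q - v * g = (u - aeval a p) * (a - algebraMap ℂ A w₀) := by
    simp only [hq, map_sub, map_one, map_mul, aeval_X, aeval_C]
    linear_combination -huv
  have hfrontier : ∀ w ∈ frontier V,
      ‖q.eval w‖ ≤ ‖(u - aeval a p) * (a - algebraMap ℂ A w₀)‖ * ‖(1 : A)‖ := fun w hw ↦
    hqa ▸ norm_eval_le_of_not_isCoprime (fun hc ↦ h w hw hc.of_mul_right_right) q
  have hle := Complex.norm_le_of_forall_mem_frontier_norm_le hV
    q.differentiable.diffContOnCl hfrontier (subset_closure hw₀)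
  have heval : q.eval w₀ = 1 := by simp [hq]
  rw [heval, norm_one] at hle
  exact hp.not_ge hle

theorem expReducible_sub_algebraMap_of_isCoprime (ha : Algebra.elemental ℂ a = ⊤) {w₀ : ℂ}
    (h : IsCoprime (a - algebraMap ℂ A w₀) g) : ExpReducible (a - algebraMap ℂ A w₀) g := by
  by_contra hred
  set V : Set ℂ := {w | IsCoprime (a - algebraMap ℂ A w) g ∧
    ¬ExpReducible (a - algebraMap ℂ A w) g}
  have hbounded : IsBounded V := by
    rw [← isCobounded_compl_iff]
    filter_upwards [eventually_cobounded_sub_algebraMap_mem_range_exp a] with w hw hwV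
    exact hwV.2 (expReducible_of_mem_range_exp hw g)
  have hfrontier : ∀ w ∈ frontier V, ¬IsCoprime (a - algebraMap ℂ A w) g := by
    intro w hw hcop
    have hcont : Continuous fun w : ℂ ↦ a - algebraMap ℂ A w := by fun_prop
    have hev : ∀ᶠ w' in 𝓝 w, IsCoprime (a - algebraMap ℂ A w') g ∧
        (ExpReducible (a - algebraMap ℂ A w') g ↔ ExpReducible (a - algebraMap ℂ A w) g) :=
      hcont.tendsto w (eventually_expReducible_iff_of_isCoprime hcop)
    by_cases hw' : ExpReducible (a - algebraMap ℂ A w) g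
    · obtain ⟨w', hw'V, -, hiff⟩ := ((mem_closure_iff_frequently.1 hw.1).and_eventually hev).exists
      exact hw'V.2 (hiff.2 hw')
    · exact hw.2 (mem_interior_iff_mem_nhds.2
        (hev.mono fun w' hw'V ↦ ⟨hw'V.1, mt hw'V.2.1 hw'⟩))
  exact not_isCoprime_of_forall_mem_frontier ha hbounded hfrontier ⟨h, hred⟩ h

theorem expReducible_aeval_of_isCoprime (ha : Algebra.elemental ℂ a = ⊤) {p : ℂ[X]}
    (h : IsCoprime (aeval a p) g) : ExpReducible (aeval a p) g := by
  let +nondep : NormedAlgebra ℚ A := .restrictScalars ℚ ℂ A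
  rcases eq_or_ne p 0 with rfl | hp
  · obtain ⟨v, hv⟩ := (isCoprime_zero_left.1 (by simpa using h)).exists_left_inv
    exact ⟨v, 0, by simp [hv]⟩
  have hfactor : aeval a p = algebraMap ℂ A p.leadingCoeff *
      (p.roots.map fun w ↦ a - algebraMap ℂ A w).prod := by
    conv_lhs => rw [(IsAlgClosed.splits p).eq_prod_roots]
    simp [map_multiset_prod, Multiset.map_map]
  rw [hfactor] at h ⊢
  refine .mul (expReducible_of_mem_range_exp ⟨_, exp_algebraMap_log (by simpa)⟩ g)
    (expReducible_multiset_prod fun f hf ↦ ?_)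
  obtain ⟨w, -, rfl⟩ := Multiset.mem_map.1 hf
  exact expReducible_sub_algebraMap_of_isCoprime ha
    (h.of_isCoprime_of_dvd_left ((Multiset.dvd_prod hf).mul_left _))

theorem expReducible_of_isCoprime (ha : Algebra.elemental ℂ a = ⊤) {f : A} (h : IsCoprime f g) :
    ExpReducible f g := by
  obtain ⟨_, ⟨p, rfl⟩, hcop, hiff⟩ := ((mem_closure_iff_frequently.1
    (denseRange_aeval_of_elemental_eq_top ha f)).and_eventually
      (eventually_expReducible_iff_of_isCoprime h)).exists
  exact hiff.1 (expReducible_aeval_of_isCoprime ha hcop)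

end SinglyGenerated

section TwoExponentials

open Matrix Matrix.GeneralLinearGroup

/-- `M` is the product of the exponentials of two matrices of trace zero. -/
def IsMulExpOfTraceZero {n R : Type*} [Fintype n] [DecidableEq n] [CommRing R] [TopologicalSpace R]
    [IsTopologicalRing R] (M : Matrix n n R) : Prop :=
  ∃ X Y : Matrix n n R, X.trace = 0 ∧ Y.trace = 0 ∧ M = exp X * exp Y

section Rat

variable {A : Type*} [NormedCommRing A] [NormedAlgebra ℚ A] [CompleteSpace A]

theorem IsMulExpOfTraceZero.units_conj {n : Type*} [Fintype n] [DecidableEq n] {M : Matrix n n A}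
    (h : IsMulExpOfTraceZero M) (U : (Matrix n n A)ˣ) :
    IsMulExpOfTraceZero (U.val * M * U⁻¹.val) := by
  obtain ⟨X, Y, hX, hY, rfl⟩ := h
  refine ⟨U.val * X * U⁻¹.val, U.val * Y * U⁻¹.val,
    by rwa [trace_units_conj], by rwa [trace_units_conj], ?_⟩
  rw [Matrix.exp_units_conj, Matrix.exp_units_conj]
  simp only [← mul_assoc, Units.inv_mul_cancel_right]

theorem exists_exp_eq_upperTriangular {x : A} (hx : IsUnit (exp x - exp (-x))) (b : A) :
    ∃ X : Matrix (Fin 2) (Fin 2) A, X.trace = 0 ∧ exp X = !![exp x, b; 0, exp (-x)] := by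
  obtain ⟨d, hd⟩ := hx.exists_right_inv
  set U : GL (Fin 2) A := upperRightHom (-(b * d)) with hU
  refine ⟨U.val * diagonal ![x, -x] * U⁻¹.val, ?_, ?_⟩
  · rw [trace_units_conj]
    simp
  · have hdiag : diagonal (exp ![x, -x]) = !![exp x, 0; 0, exp (-x)] := by
      ext i j
      fin_cases i <;> fin_cases j <;> simp [Pi.coe_exp]
    rw [Matrix.exp_units_conj, Matrix.exp_diagonal, hdiag, hU, ← AddChar.map_neg_eq_inv]
    have hb : exp x * (b * d) + -(b * d) * exp (-x) = b := by linear_combination b * hd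
    simp only [upperRightHom_apply, mul_fin_two, mul_zero, zero_mul, mul_one, one_mul, add_zero,
      zero_add, neg_neg, hb]

theorem exists_exp_eq_lowerTriangular {x : A} (hx : IsUnit (exp x - exp (-x))) (c : A) :
    ∃ X : Matrix (Fin 2) (Fin 2) A, X.trace = 0 ∧ exp X = !![exp x, 0; c, exp (-x)] := by
  obtain ⟨X, hX, hexp⟩ := exists_exp_eq_upperTriangular hx c
  refine ⟨Xᵀ, by rwa [trace_transpose], ?_⟩
  rw [Matrix.exp_transpose, hexp]
  exact (eta_fin_two _).trans rfl

theorem eq_lowerTriangular_mul_upperTriangular {R : Type*} [CommRing R]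
    {M : Matrix (Fin 2) (Fin 2) R} (hM : M.det = 1) {x x' y y' : R} (hx : x * x' = 1)
    (hy : y * y' = 1) (h : M 0 0 = x * y) :
    M = !![x, 0; M 1 0 * y', x'] * !![y, x' * M 0 1; 0, y'] := by
  rw [det_fin_two] at hM
  have h₀₁ : x * (x' * M 0 1) = M 0 1 := by linear_combination M 0 1 * hx
  have h₁₀ : M 1 0 * y' * y = M 1 0 := by linear_combination M 1 0 * hy
  have h₁₁ : M 1 0 * y' * (x' * M 0 1) + x' * y' = M 1 1 := by
    linear_combination -x' * y' * hM + M 1 1 * x' * y' * h + M 1 1 * (y * y' * hx + hy)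
  simp only [mul_fin_two, mul_zero, zero_mul, add_zero, h₀₁, h₁₀, h₁₁, ← h]
  exact eta_fin_two M

theorem isMulExpOfTraceZero_of_apply_zero_zero {M : Matrix (Fin 2) (Fin 2) A} (hM : M.det = 1)
    {x y : A} (h : M 0 0 = exp x * exp y) (hx : IsUnit (exp x - exp (-x)))
    (hy : IsUnit (exp y - exp (-y))) : IsMulExpOfTraceZero M := by
  obtain ⟨X, hX, hXexp⟩ := exists_exp_eq_lowerTriangular hx (M 1 0 * exp (-y))
  obtain ⟨Y, hY, hYexp⟩ := exists_exp_eq_upperTriangular hy (exp (-x) * M 0 1)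
  refine ⟨X, Y, hX, hY, ?_⟩
  rw [hXexp, hYexp]
  exact eq_lowerTriangular_mul_upperTriangular hM (exp_mul_exp_neg x) (exp_mul_exp_neg y) h

theorem isUnit_exp_sub_exp_neg_iff {x : A} :
    IsUnit (exp x - exp (-x)) ↔ IsUnit (exp (x + x) - 1) := by
  have hfactor : exp x * (exp x - exp (-x)) = exp (x + x) - 1 := by
    rw [mul_sub, exp_mul_exp_neg, exp_add]
  rw [← hfactor, IsUnit.mul_iff, and_iff_right (isUnit_exp x)]

end Rat

variable {A : Type*} [NormedCommRing A] [NormedAlgebra ℂ A] [CompleteSpace A]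

theorem exists_add_eq_isUnit_exp_sub_exp_neg (z : A) :
    ∃ x y : A, x + y = z ∧ IsUnit (exp x - exp (-x)) ∧ IsUnit (exp y - exp (-y)) := by
  let +nondep : NormedAlgebra ℚ A := .restrictScalars ℚ ℂ A
  obtain ⟨r, hrz, hr⟩ : ∃ r : ℝ, ‖exp (z + z)‖ * ‖(1 : A)‖ < r ∧ 1 < r :=
    ((eventually_gt_atTop _).and (eventually_gt_atTop 1)).exists
  have hr0 : (r : ℂ) ≠ 0 := by exact_mod_cast (one_pos.trans hr).ne'
  set y : A := algebraMap ℂ A (Complex.log r / 2) with hy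
  have hexp : exp (y + y) = algebraMap ℂ A r := by
    rw [hy, ← map_add, add_halves, exp_algebraMap_log hr0]
  refine ⟨z - y, y, sub_add_cancel z y, isUnit_exp_sub_exp_neg_iff.2 ?_,
    isUnit_exp_sub_exp_neg_iff.2 ?_⟩
  · have hunit : IsUnit (algebraMap ℂ A r - exp (z + z)) :=
      spectrum.mem_resolventSet_of_norm_lt_mul
        (by rwa [Complex.norm_of_nonneg (one_pos.trans hr).le])
    have hsplit : exp (z + z) = exp (z - y + (z - y)) * exp (y + y) := by
      rw [← exp_add]
      congr 1
      ring
    have hfactor : algebraMap ℂ A r - exp (z + z) =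
        -((exp (z - y + (z - y)) - 1) * algebraMap ℂ A r) := by
      rw [hsplit, hexp]
      ring
    rw [hfactor, IsUnit.neg_iff] at hunit
    exact isUnit_of_mul_isUnit_left hunit
  · rw [hexp, ← map_one (algebraMap ℂ A), ← map_sub]
    exact (IsUnit.mk0 _ (sub_ne_zero.2 (by exact_mod_cast hr.ne'))).map _

theorem isMulExpOfTraceZero_of_expReducible {M : Matrix (Fin 2) (Fin 2) A} (hM : M.det = 1)
    (h : ExpReducible (M 0 0) (M 1 0)) : IsMulExpOfTraceZero M := by
  let +nondep : NormedAlgebra ℚ A := .restrictScalars ℚ ℂ A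
  obtain ⟨α, z, hz⟩ := h
  obtain ⟨x, y, rfl, hx, hy⟩ := exists_add_eq_isUnit_exp_sub_exp_neg z
  set U : GL (Fin 2) A := upperRightHom α with hU
  have hconj : IsMulExpOfTraceZero (U.val * M * U⁻¹.val) := by
    refine isMulExpOfTraceZero_of_apply_zero_zero (by rwa [det_units_conj]) ?_ hx hy
    rw [← exp_add, hz, hU, ← AddChar.map_neg_eq_inv]
    simp [mul_apply, vecMul_eq_sum, Fin.sum_univ_two]
  simpa [mul_assoc] using hconj.units_conj U⁻¹

theorem theorem2_general {a : A} (ha : Algebra.elemental ℂ a = ⊤)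
    (M : SpecialLinearGroup (Fin 2) A) :
    ∃ X Y : Matrix (Fin 2) (Fin 2) A, X.trace = 0 ∧ Y.trace = 0 ∧
      (M : Matrix (Fin 2) (Fin 2) A) = exp X * exp Y :=
  isMulExpOfTraceZero_of_expReducible M.det_coe (expReducible_of_isCoprime ha (M.isCoprime_col 0))

end TwoExponentials

namespace discAlgebra

theorem extend_apply (f : discAlgebra) (z : closedBall (0 : ℂ) 1) :
    Function.extend Subtype.val f.1 0 (z : ℂ) = f.1 z :=
  Subtype.val_injective.extend_apply _ _ _

theorem diffContOnCl_extend (f : discAlgebra) :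
    DiffContOnCl ℂ (Function.extend Subtype.val f.1 0) (ball (0 : ℂ) 1) := by
  refine ⟨f.2, ?_⟩
  rw [closure_ball _ one_ne_zero, continuousOn_iff_continuous_domRestrict]
  exact f.1.continuous.congr fun z ↦ (extend_apply f z).symm

/-- The element of the disc algebra given by a function on `ℂ` that is holomorphic on the open
disc and continuous up to the boundary. -/
def ofDiffContOnCl (F : ℂ → ℂ) (hF : DiffContOnCl ℂ F (ball (0 : ℂ) 1)) : discAlgebra :=
  ⟨⟨fun z ↦ F z, hF.continuousOn_ball.domRestrict⟩, hF.1.congr fun z hz ↦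
    Subtype.val_injective.extend_apply (fun z : closedBall (0 : ℂ) 1 ↦ F z) 0
      ⟨z, ball_subset_closedBall hz⟩⟩

theorem isClosed_coe : IsClosed (discAlgebra : Set C(closedBall (0 : ℂ) 1, ℂ)) := by
  refine isClosed_of_closure_subset fun f hf ↦ ?_
  obtain ⟨u, hu, hlim⟩ := mem_closure_iff_seq_limit.1 hf
  have hunif : TendstoUniformlyOn (fun n ↦ Function.extend Subtype.val (u n) 0)
      (Function.extend Subtype.val f 0) atTop (ball (0 : ℂ) 1) := by
    rw [ContinuousMap.tendsto_iff_tendstoUniformly, Metric.tendstoUniformly_iff] at hlim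
    refine Metric.tendstoUniformlyOn_iff.2 fun ε hε ↦ (hlim ε hε).mono fun n hn z hz ↦ ?_
    lift z to closedBall (0 : ℂ) 1 using ball_subset_closedBall hz
    simpa only [Subtype.val_injective.extend_apply] using hn z
  exact hunif.tendstoLocallyUniformlyOn.differentiableOn (.of_forall hu) isOpen_ball

instance : CompleteSpace discAlgebra := isClosed_coe.completeSpace_coe

/-- The coordinate function `z`, the topological generator of the disc algebra. -/
def coord : discAlgebra := ofDiffContOnCl id differentiable_id.diffContOnCl

theorem diffContOnCl_extend_mul (f : discAlgebra) (w : closedBall (0 : ℂ) 1) :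
    DiffContOnCl ℂ (fun z ↦ Function.extend Subtype.val f.1 0 (w * z)) (ball (0 : ℂ) 1) := by
  have hmul : Differentiable ℂ fun z : ℂ ↦ (w : ℂ) * z := by fun_prop
  refine (diffContOnCl_extend f).comp hmul.diffContOnCl fun z hz ↦ ?_
  rw [mem_ball_zero_iff] at hz ⊢
  exact norm_mul (w : ℂ) z ▸ mul_lt_one_of_nonneg_of_lt_one_right
    (mem_closedBall_zero_iff.1 w.2) (norm_nonneg z) hz

/-- The dilation `z ↦ f (w * z)` of `f` by a point `w` of the closed disc. For `‖w‖ < 1` it is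
holomorphic on a neighbourhood of the closed disc. -/
noncomputable def dilate (f : discAlgebra) (w : closedBall (0 : ℂ) 1) : discAlgebra :=
  ofDiffContOnCl _ (diffContOnCl_extend_mul f w)

theorem dilate_apply (f : discAlgebra) (w z : closedBall (0 : ℂ) 1) :
    (dilate f w).1 z = f.1 (w * z) :=
  extend_apply f (w * z)

theorem dilate_one (f : discAlgebra) : dilate f 1 = f :=
  Subtype.ext <| ContinuousMap.ext fun z ↦ by rw [dilate_apply, one_mul]

theorem continuous_dilate (f : discAlgebra) : Continuous (dilate f) := by
  let F : C(closedBall (0 : ℂ) 1 × closedBall (0 : ℂ) 1, ℂ) :=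
    ⟨fun p ↦ f.1 (p.1 * p.2), by fun_prop⟩
  refine continuous_induced_rng.2 (F.curry.continuous.congr fun w ↦ ?_)
  exact ContinuousMap.ext fun z ↦ (dilate_apply f w z).symm

theorem tendsto_sum_coord_pow_dilate (f : discAlgebra) {w : closedBall (0 : ℂ) 1}
    (hw : ‖(w : ℂ)‖ < 1) :
    Tendsto (fun n ↦ ∑ k ∈ Finset.range n, ((w : ℂ) ^ k *
      (cauchyPowerSeries (Function.extend Subtype.val f.1 0) 0 1).coeff k) • coord ^ k)
      atTop (𝓝 (dilate f w)) := by
  have hps := (diffContOnCl_extend f).hasFPowerSeriesOnBall (R := 1) one_pos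
  obtain ⟨r, hwr, hr⟩ := exists_between hw
  lift r to NNReal using (norm_nonneg _).trans hwr.le
  have hmem : ∀ z : closedBall (0 : ℂ) 1, (w * z : ℂ) ∈ ball (0 : ℂ) r := fun z ↦ by
    rw [mem_ball_zero_iff, norm_mul]
    exact (mul_le_of_le_one_right (norm_nonneg _) (mem_closedBall_zero_iff.1 z.2)).trans_lt hwr
  have hunif := tendstoUniformlyOn_univ.1 <|
    ((hps.tendstoUniformlyOn (r' := r) (by exact_mod_cast hr)).comp
      fun z : closedBall (0 : ℂ) 1 ↦ (w * z : ℂ)).mono fun z _ ↦ hmem z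
  rw [tendsto_subtype_rng, ContinuousMap.tendsto_iff_tendstoUniformly]
  convert hunif using 2 with n
  · ext z
    simp [FormalMultilinearSeries.partialSum, coord, ofDiffContOnCl, mul_pow, mul_right_comm]
  · simp only [zero_add]
    rfl

theorem elemental_coord_eq_top : Algebra.elemental ℂ coord = ⊤ := by
  have hclosed : IsClosed (Algebra.elemental ℂ coord : Set discAlgebra) :=
    Algebra.elemental.isClosed ℂ coord
  refine eq_top_iff.2 fun f _ ↦ ?_
  have hsub : {w : closedBall (0 : ℂ) 1 | ‖(w : ℂ)‖ < 1} ⊆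
      {w | dilate f w ∈ Algebra.elemental ℂ coord} := fun w hw ↦
    hclosed.mem_of_tendsto (tendsto_sum_coord_pow_dilate f hw) (.of_forall fun n ↦ sum_mem fun k _ ↦
      Subalgebra.smul_mem _ (pow_mem (Algebra.elemental.self_mem ℂ coord) k) _)
  have hone : (1 : closedBall (0 : ℂ) 1) ∈ closure {w : closedBall (0 : ℂ) 1 | ‖(w : ℂ)‖ < 1} := by
    have himage : Subtype.val '' {w : closedBall (0 : ℂ) 1 | ‖(w : ℂ)‖ < 1} = ball (0 : ℂ) 1 := by
      ext z
      simp +contextual [le_of_lt]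
    rw [closure_subtype, himage, closure_ball _ one_ne_zero]
    exact Subtype.coe_prop 1
  exact dilate_one f ▸ closure_minimal hsub (hclosed.preimage (continuous_dilate f)) hone

end discAlgebra

theorem theorem2 (M : Matrix.SpecialLinearGroup (Fin 2) discAlgebra) :
    ∃ X Y : Matrix (Fin 2) (Fin 2) discAlgebra,
      X.trace = 0 ∧ Y.trace = 0 ∧
        (M : Matrix (Fin 2) (Fin 2) discAlgebra) = NormedSpace.exp X * NormedSpace.exp Y :=
  theorem2_general discAlgebra.elemental_coord_eq_top M
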